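/- Let $R$ be a monoid with group of units $W$ and set of idempotents $E(R)$. Call $R$ \emph{factorizable} if $R = E(R)W = WE(R)$ and the idempotents of $R$ commute; then $E(R)$ is a meet semilattice for the order $e \le f \Leftrightarrow ef = fe = e$, with meet $ef$. A \emph{generalized Renner--Coxeter system} is a triple $(R,\Lambda,S)$ such that (i) $R$ is a factorizable monoid with group of units $W$; (ii) $\Lambda \subseteq E(R)$ is a transversal for the conjugation action of $W$ on $E(R)$ and is closed under meets; (iii) $(W,S)$ is a Coxeter system ($S$ may be infinite); (iv) for all $e \le e'$ in $E(R)$ there are $w \in W$ and $f \le f'$ in $\Lambda$ with $wew^{-1} = f$ and $we'w^{-1} = f'$; (v) the map $\lambda^*(e) = \{s \in S : se = es \ne e\}$ on $\Lambda$ satisfies $\lambda^*(e) \subseteq \lambda^*(f)$ whenever $e \le f$; (vi) for every $e \in \Lambda$ the groups $\{w \in W : we = ew\}$ and $\{w \in W : we = ew = e\}$ are standard parabolic subgroups of $W$. For $I \subseteq S$ let $W_I$ be the subgroup generated by $I$. Write $\lambda(e) = \{s \in S: se = es\}$ and $\lambda_*(e) = \{s \in S : se = es = e\}$, so that the groups in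 (vi) are $W_{\lambda(e)}$ and $W_{\lambda_*(e)}$. The Bruhat order on $W$ is: $u \le v$ if and only if some reduced word for $v$ has a subword that is a reduced word for $u$. Let ${}^{I}W$ (respectively $W^{I}$) be the set of those $u \in W$ that are the Bruhat minimum of the coset $W_I u$ (respectively $uW_I$). A \emph{left standard form} of $r \in R$ is an expression $r = xey$ with $e \in \Lambda$, $x \in W^{\lambda_*(e)}$, $y \in {}^{\lambda(e)}W$. A \emph{right standard form} of $r$ is an expression $r = yex$ with $e \in \Lambda$, $x \in {}^{\lambda_*(e)}W$, $y \in W^{\lambda(e)}$. (Each element of $R$ has exactly one of each.) The \emph{Adherence relations} on $R$ are defined as follows. If $r = xey$ and $s = afb$ are in left standard form, then $r \le^{+} s$ if and only if $e \le f$ and there is $w \in W_{\lambda^*(f)}W_{\lambda_*(e)}$ with $x \le aw$ and $w^{-1}b \le y$ in the Bruhat order. If $r = yex$ and $s = bfa$ are in right standard form, then $r \le^{-} s$ if and only if $e \le f$ and there is $w \in W_{\lambda_*(e)}W_{\lambda^*(f)}$ with $x \le wa$ and $bw^{-1} \le y$ in the Bruhat order. \textbf{Theorem.} Let $(R,\Lambda,S)$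 be a generalized Renner--Coxeter system. For $\varepsilon = +$ and for $\varepsilon = -$: (1) $\le^{\varepsilon}$ is a partial order on $R$; (2) for $u, v \in W$, $u \le^{\varepsilon} v$ if and only if $u \le v$ in the Bruhat order; (3) for $e, f \in \Lambda$, $e \le^{\varepsilon} f$ if and only if $e \le f$ (that is, $ef = fe = e$); (4) for $e, f \in E(R)$, $e \le^{\varepsilon} f$ if and only if $e \le f$ (that is, $ef = fe = e$). -/

import Mathlib

open scoped Pointwise

namespace RennerCoxeter

section Coxeter

variable {B : Type*} {M : CoxeterMatrix B} {W : Type*} [Group W] (cs : CoxeterSystem M W)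

/-- The Bruhat order `u ≤ v` of a Coxeter group: some reduced word for `v` has a subword that is
a reduced word for `u`. -/
def BruhatLE (u v : W) : Prop :=
  ∃ ω : List B, cs.IsReduced ω ∧ cs.wordProd ω = v ∧
    ∃ ω' : List B, ω'.Sublist ω ∧ cs.IsReduced ω' ∧ cs.wordProd ω' = u

/-- The standard parabolic subgroup `W_I` generated by the simple reflections in `I`. -/
def parabolic (I : Set B) : Subgroup W := Subgroup.closure (cs.simple '' I)

/-- The set `ᴵWᴶ` of those `u` that are the Bruhat minimum of the double coset `W_I u W_J`. -/
def minReps (I J : Set B) : Set W :=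
  {u | ∀ a ∈ parabolic cs I, ∀ b ∈ parabolic cs J, BruhatLE cs u (a * u * b)}

/-- The set `Wᴶ` of minimum representatives of the cosets `u W_J`. -/
def minRightReps (J : Set B) : Set W := minReps cs ∅ J

/-- The set `ᴵW` of minimum representatives of the cosets `W_I u`. -/
def minLeftReps (I : Set B) : Set W := minReps cs I ∅

end Coxeter

section Monoid

variable {R : Type*} [Monoid R]

/-- The order on idempotents: `e ≤ f` if and only if `ef = fe = e`. -/
def IdemLE (e f : R) : Prop := e * f = e ∧ f * e = e

/-- A factorizable monoid: every element is a product of an idempotent and a unit (in either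
order), and idempotents commute, so that they form a meet semilattice for `IdemLE`, the meet
of `e` and `f` being `e * f`. -/
structure IsFactorizable (R : Type*) [Monoid R] : Prop where
  exists_idem_mul_unit : ∀ r : R, ∃ e : R, IsIdempotentElem e ∧ ∃ u : Rˣ, r = e * u
  exists_unit_mul_idem : ∀ r : R, ∃ e : R, IsIdempotentElem e ∧ ∃ u : Rˣ, r = u * e
  idem_comm : ∀ e f : R, IsIdempotentElem e → IsIdempotentElem f → e * f = f * e

/-- The subgroup `{w ∈ W | we = ew}` of the unit group. -/
def commSubgroup (e : R) : Subgroup Rˣ where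
  carrier := {w | (w : R) * e = e * w}
  one_mem' := by simp
  mul_mem' := by
    intro a b ha hb
    change (a : R) * e = e * a at ha
    change (b : R) * e = e * b at hb
    change ((a * b : Rˣ) : R) * e = e * ((a * b : Rˣ) : R)
    rw [Units.val_mul, mul_assoc, hb, ← mul_assoc, ha, mul_assoc]
  inv_mem' := by
    intro a ha
    change (a : R) * e = e * a at ha
    change ((a⁻¹ : Rˣ) : R) * e = e * ((a⁻¹ : Rˣ) : R)
    rw [Units.inv_mul_eq_iff_eq_mul, ← mul_assoc, ha, mul_assoc, Units.mul_inv, mul_one]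

/-- The subgroup `{w ∈ W | we = ew = e}` of the unit group. -/
def fixSubgroup (e : R) : Subgroup Rˣ where
  carrier := {w | (w : R) * e = e ∧ e * (w : R) = e}
  one_mem' := by simp
  mul_mem' := by
    rintro a b ⟨ha, ha'⟩ ⟨hb, hb'⟩
    refine ⟨?_, ?_⟩
    · rw [Units.val_mul, mul_assoc, hb, ha]
    · rw [Units.val_mul, ← mul_assoc, ha', hb']
  inv_mem' := by
    rintro a ⟨ha, ha'⟩
    refine ⟨?_, ?_⟩
    · rw [Units.inv_mul_eq_iff_eq_mul, ha]
    · rw [Units.mul_inv_eq_iff_eq_mul, ha']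

variable {B : Type*} {M : CoxeterMatrix B} (cs : CoxeterSystem M Rˣ)

/-- The type map `λ(e)`, that is `{s ∈ S | se = es}`. -/
def typeMap (e : R) : Set B := {i | (cs.simple i : R) * e = e * cs.simple i}

/-- The lower type map `λ_*(e)`, that is `{s ∈ S | se = es = e}`. -/
def lowerTypeMap (e : R) : Set B :=
  {i | (cs.simple i : R) * e = e ∧ e * (cs.simple i : R) = e}

/-- The upper type map `λ^*(e)`, that is `{s ∈ S | se = es ≠ e}`. -/
def upperTypeMap (e : R) : Set B :=
  {i | (cs.simple i : R) * e = e * cs.simple i ∧ e * (cs.simple i : R) ≠ e}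

/-- A generalized Renner-Coxeter system `(R, Λ, S)`. The group of units of `R` is `W = Rˣ`, and
`S` is the set of simple reflections of the Coxeter system `cs` on `W`. -/
structure IsGenRennerCoxeterSystem (Λ : Set R) : Prop where
  factorizable : IsFactorizable R
  idem_of_mem : ∀ e ∈ Λ, IsIdempotentElem e
  transversal : ∀ e : R, IsIdempotentElem e → ∃! f : R, f ∈ Λ ∧ ∃ w : Rˣ, w * e * ↑w⁻¹ = f
  inf_mem : ∀ e ∈ Λ, ∀ f ∈ Λ, e * f ∈ Λ
  conj_pair : ∀ e e' : R, IsIdempotentElem e → IsIdempotentElem e' → IdemLE e e' →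
    ∃ w : Rˣ, ∃ f ∈ Λ, ∃ f' ∈ Λ, IdemLE f f' ∧ w * e * ↑w⁻¹ = f ∧ w * e' * ↑w⁻¹ = f'
  upperTypeMap_mono : ∀ e ∈ Λ, ∀ f ∈ Λ, IdemLE e f → upperTypeMap cs e ⊆ upperTypeMap cs f
  comm_parabolic : ∀ e ∈ Λ, ∃ I : Set B, commSubgroup e = parabolic cs I
  fix_parabolic : ∀ e ∈ Λ, ∃ I : Set B, fixSubgroup e = parabolic cs I

/-- `λ(e)` is the set of simple reflections for which `W_{λ(e)} = {w ∈ W | we = ew}`. -/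
theorem IsGenRennerCoxeterSystem.parabolic_typeMap {Λ : Set R}
    (h : IsGenRennerCoxeterSystem cs Λ) {e : R} (he : e ∈ Λ) :
    parabolic cs (typeMap cs e) = commSubgroup e := by
  obtain ⟨I, hI⟩ := h.comm_parabolic e he
  apply le_antisymm
  · refine (Subgroup.closure_le _).2 ?_
    rintro _ ⟨i, hi, rfl⟩
    exact hi
  · rw [hI]
    refine Subgroup.closure_mono (Set.image_mono fun i hi => ?_)
    have : cs.simple i ∈ commSubgroup e := by
      rw [hI]; exact Subgroup.subset_closure ⟨i, hi, rfl⟩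
    exact this

/-- `λ_*(e)` is the set of simple reflections for which
`W_{λ_*(e)} = {w ∈ W | we = ew = e}`. -/
theorem IsGenRennerCoxeterSystem.parabolic_lowerTypeMap {Λ : Set R}
    (h : IsGenRennerCoxeterSystem cs Λ) {e : R} (he : e ∈ Λ) :
    parabolic cs (lowerTypeMap cs e) = fixSubgroup e := by
  obtain ⟨I, hI⟩ := h.fix_parabolic e he
  apply le_antisymm
  · refine (Subgroup.closure_le _).2 ?_
    rintro _ ⟨i, hi, rfl⟩
    exact hi
  · rw [hI]
    refine Subgroup.closure_mono (Set.image_mono fun i hi => ?_)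
    have : cs.simple i ∈ fixSubgroup e := by
      rw [hI]; exact Subgroup.subset_closure ⟨i, hi, rfl⟩
    exact this

/-- `r = x e y` is in left standard form: `e ∈ Λ`, `x` is in `W^{λ_*(e)}`, and `y` is in
`^{λ(e)}W`. -/
def IsLeftStandardForm (Λ : Set R) (r : R) (x : Rˣ) (e : R) (y : Rˣ) : Prop :=
  r = x * e * y ∧ e ∈ Λ ∧ x ∈ minRightReps cs (lowerTypeMap cs e) ∧
    y ∈ minLeftReps cs (typeMap cs e)

/-- `r = y e x` is in right standard form: `e ∈ Λ`, `x` is in `^{λ_*(e)}W`, and `y` is in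
`W^{λ(e)}`. -/
def IsRightStandardForm (Λ : Set R) (r : R) (y : Rˣ) (e : R) (x : Rˣ) : Prop :=
  r = y * e * x ∧ e ∈ Λ ∧ x ∈ minLeftReps cs (lowerTypeMap cs e) ∧
    y ∈ minRightReps cs (typeMap cs e)

/-- The relation `r ≤⁺ s`, in terms of the left standard forms `r = x e y`, `s = a f b`. -/
def AdherencePlusLE (Λ : Set R) (r s : R) : Prop :=
  ∃ (x : Rˣ) (e : R) (y : Rˣ) (a : Rˣ) (f : R) (b : Rˣ),
    IsLeftStandardForm cs Λ r x e y ∧ IsLeftStandardForm cs Λ s a f b ∧ IdemLE e f ∧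
    ∃ w ∈ (parabolic cs (upperTypeMap cs f) : Set Rˣ) * (parabolic cs (lowerTypeMap cs e) : Set Rˣ),
      BruhatLE cs x (a * w) ∧ BruhatLE cs (w⁻¹ * b) y

/-- The relation `r ≤⁻ s`, in terms of the right standard forms `r = y e x`, `s = b f a`. -/
def AdherenceMinusLE (Λ : Set R) (r s : R) : Prop :=
  ∃ (y : Rˣ) (e : R) (x : Rˣ) (b : Rˣ) (f : R) (a : Rˣ),
    IsRightStandardForm cs Λ r y e x ∧ IsRightStandardForm cs Λ s b f a ∧ IdemLE e f ∧
    ∃ w ∈ (parabolic cs (lowerTypeMap cs e) : Set Rˣ) * (parabolic cs (upperTypeMap cs f) : Set Rˣ),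
      BruhatLE cs x (w * a) ∧ BruhatLE cs (b * w⁻¹) y

/-- The two signs `ε = +` and `ε = -`. -/
inductive AdherenceSign
  | plus
  | minus

/-- The relation `r ≤^ε s`. -/
def AdherenceLE (Λ : Set R) : AdherenceSign → R → R → Prop
  | .plus => AdherencePlusLE cs Λ
  | .minus => AdherenceMinusLE cs Λ

end Monoid

end RennerCoxeter

/-!
The Bruhat order of a Coxeter group is first shown to be the reflexive transitive closure of the
relation `u < tu`, `t` a reflection with `ℓ(u) < ℓ(tu)`. This rests on the strong exchange property
`exists_eraseIdx_of_isLeftInversion`, proved through the action of `W` on `W × ℤ/2` that records the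
parity of the number of occurrences of an element in the inversion sequence of a word. The lifting
properties `BruhatLE.simple_mul_or` and `BruhatLE.simple_mul_or'` follow, and from them two
statements on parabolic subgroups. Passing to cosets of `W_I` is monotone
(`BruhatLE.exists_parabolic_mul`). If `α ≤ α'`, `d ≤ y`, `y` is minimal in `W_I y` and `p ∈ W_I`,
then a single `p' ∈ W_I` satisfies both `pα ≤ p'α'` and `p'd ≤ py`
(`BruhatLE.exists_parabolic_mul_pair`).

For `e ∈ Λ`, the subgroup `W_{λ_*(e)}` is normal in the centralizer `W_{λ(e)}` of `e`. By exchange,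
the generators in `λ^*(e)` then commute with those in `λ_*(e)`, so that
`W_{λ(e)} = W_{λ^*(e)} W_{λ_*(e)}` with commuting factors. Since `x` is minimal in `x W_{λ_*(e)}`,
the relation `xey ≤⁺ afb` amounts to `e ≤ f` together with `x⁻¹ ≤ p a⁻¹` and `q p b ≤ y` for
independent `p ∈ W_{λ^*(f)}` and `q ∈ W_{λ_*(e)}` (`adherencePlusLE_iff`).

In this form, transitivity is an application of the two statements on parabolic subgroups, the new
factors staying in place because `λ^*` is increasing and `λ_*` is decreasing on `Λ`.
Antisymmetry holds because `b ≤ q p b ≤ y` and the symmetric inequalities force `y = b` and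
`q p = 1`. An idempotent has the standard form `y⁻¹ e y`. If the relation holds between `y⁻¹ e y`
and `b⁻¹ f b`, then `y = q p b`, so that one unit conjugates the two idempotents to `e` and `f`; a
common conjugating unit conversely provides `p` and `q`.

A factorizable monoid is an inverse monoid, and its involution `u e v ↦ v⁻¹ e u⁻¹` exchanges left
and right standard forms. It carries `≤⁻` to `≤⁺`, fixes the idempotents and inverts the units, so
the statements on `≤⁻` follow from those on `≤⁺`.
-/

namespace RennerCoxeter

section Bruhat

variable {B : Type*} {M : CoxeterMatrix B} {W : Type*} [Group W] (cs : CoxeterSystem M W)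

/-! ### The strong exchange property -/

theorem functionEnd_mul_apply {α : Type*} (f g : Function.End α) (x : α) :
    (f * g) x = f (g x) := rfl

open Classical in
/-- The map `(t, ε) ↦ (s t s, ε + [s t s = s])` of `W × ℤ/2` attached to a simple reflection `s`. On
reflections `t`, these maps generate the action of `W` on its (signed) roots. -/
noncomputable def signedConj (i : B) : Function.End (W × ZMod 2) :=
  fun p => (MulAut.conj (cs.simple i) p.1,
    p.2 + if MulAut.conj (cs.simple i) p.1 = cs.simple i then 1 else 0)

open Classical in
theorem prod_map_signedConj (ω : List B) (t : W) (c : ZMod 2) :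
    (ω.map (signedConj cs)).prod (t, c) = (cs.wordProd ω * t * (cs.wordProd ω)⁻¹,
      c + ((cs.leftInvSeq ω).count (cs.wordProd ω * t * (cs.wordProd ω)⁻¹) : ZMod 2)) := by
  induction ω with
  | nil => simp [Function.End.one_def]
  | cons i ω ih =>
    have hconj : cs.wordProd (i :: ω) * t * (cs.wordProd (i :: ω))⁻¹ =
        MulAut.conj (cs.simple i) (cs.wordProd ω * t * (cs.wordProd ω)⁻¹) := by
      simp [cs.wordProd_cons, mul_assoc]
    rw [List.map_cons, List.prod_cons, functionEnd_mul_apply, ih, hconj,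
      CoxeterSystem.leftInvSeq, List.count_cons,
      List.count_map_of_injective _ _ (MulAut.conj (cs.simple i)).injective]
    simp only [signedConj, beq_iff_eq, Nat.cast_add, Nat.cast_ite, Nat.cast_one, Nat.cast_zero,
      add_assoc, eq_comm (a := cs.simple i)]

theorem prod_map_alternatingWord {G : Type*} [Monoid G] (f : B → G) (i j : B) (n : ℕ) :
    ((CoxeterSystem.alternatingWord i j (2 * n)).map f).prod = (f i * f j) ^ n := by
  induction n with
  | zero => simp [CoxeterSystem.alternatingWord]
  | succ n ih =>
    rw [show 2 * (n + 1) = 2 * n + 1 + 1 by ring, CoxeterSystem.alternatingWord_succ',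
      CoxeterSystem.alternatingWord_succ', pow_succ', ← ih]
    simp [mul_assoc]

open Classical in
/-- The left inversion sequence of the word `(ij)^m`, `m` the order of `s_i s_j`, is periodic with
period `m`, so every element occurs in it an even number of times. -/
theorem count_leftInvSeq_alternatingWord (i j : B) (t : W) :
    ((cs.leftInvSeq (CoxeterSystem.alternatingWord i j (2 * M i j))).count t : ZMod 2) = 0 := by
  set L := cs.leftInvSeq (CoxeterSystem.alternatingWord i j (2 * M i j)) with hL
  have hlen : L.length = 2 * M i j := by simp [hL]
  have key : L.drop (M i j) = L.take (M i j) := by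
    apply List.ext_getElem
    · simp [hlen]; omega
    · intro k h1 h2
      have hk : k < M i j := by simp [hlen] at h2; omega
      rw [List.getElem_drop, List.getElem_take]
      simp only [hL]
      rw [cs.getElem_leftInvSeq_alternatingWord i j _ _ (by omega),
        cs.getElem_leftInvSeq_alternatingWord i j _ _ (by omega),
        cs.prod_alternatingWord_eq_mul_pow, cs.prod_alternatingWord_eq_mul_pow,
        show (2 * (M i j + k) + 1) / 2 = M i j + k by omega,
        show (2 * k + 1) / 2 = k by omega, pow_add, cs.simple_mul_simple_pow']
      simp
  rw [← List.take_append_drop (M i j) L, key, List.count_append, Nat.cast_add]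
  exact CharTwo.add_self_eq_zero _

theorem isLiftable_signedConj : M.IsLiftable (signedConj cs) := by
  classical
  intro i j
  funext ⟨t, c⟩
  rw [← prod_map_alternatingWord, prod_map_signedConj, count_leftInvSeq_alternatingWord]
  have : cs.wordProd (CoxeterSystem.alternatingWord i j (2 * M i j)) = 1 := by
    rw [CoxeterSystem.wordProd, prod_map_alternatingWord, cs.simple_mul_simple_pow]
  simp [this, Function.End.one_def]

/-- The action of `W` on `W × ℤ/2` extending `signedConj`. -/
noncomputable def signedConjHom : W →* Function.End (W × ZMod 2) :=
  cs.lift ⟨signedConj cs, isLiftable_signedConj cs⟩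

theorem signedConjHom_simple (i : B) : signedConjHom cs (cs.simple i) = signedConj cs i :=
  cs.lift_apply_simple (isLiftable_signedConj cs) i

open Classical in
/-- The parity of the number of occurrences of `t` in the left inversion sequence of a word depends
only on the product of the word. -/
theorem signedConjHom_wordProd (ω : List B) (t : W) (c : ZMod 2) :
    signedConjHom cs (cs.wordProd ω) (t, c) = (cs.wordProd ω * t * (cs.wordProd ω)⁻¹,
      c + ((cs.leftInvSeq ω).count (cs.wordProd ω * t * (cs.wordProd ω)⁻¹) : ZMod 2)) := by
  rw [← prod_map_signedConj, CoxeterSystem.wordProd, map_list_prod, List.map_map]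
  rw [show (signedConjHom cs ∘ cs.simple) = signedConj cs from
    funext (signedConjHom_simple cs)]

theorem signedConjHom_apply (w t : W) (c : ZMod 2) :
    signedConjHom cs w (t, c) = (w * t * w⁻¹, c + (signedConjHom cs w (t, 0)).2) := by
  classical
  obtain ⟨ω, -, rfl⟩ := cs.exists_isReduced w
  simp [signedConjHom_wordProd]

theorem signedConjHom_reflection {t : W} (ht : cs.IsReflection t) (c : ZMod 2) :
    signedConjHom cs t (t, c) = (t, c + 1) := by
  obtain ⟨u, i, rfl⟩ := ht
  have hs (c : ZMod 2) :
      signedConjHom cs (cs.simple i) (cs.simple i, c) = (cs.simple i, c + 1) := by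
    rw [signedConjHom_simple]; simp [signedConj]
  have h1 : signedConjHom cs u⁻¹ (u * cs.simple i * u⁻¹, c) =
      (cs.simple i, c + (signedConjHom cs u⁻¹ (u * cs.simple i * u⁻¹, 0)).2) := by
    rw [signedConjHom_apply]; congr 1; group
  have h2 : signedConjHom cs u (signedConjHom cs u⁻¹ (u * cs.simple i * u⁻¹, c)) =
      (u * cs.simple i * u⁻¹, c) :=
    (functionEnd_mul_apply _ _ _).symm.trans (by
      rw [← map_mul, mul_inv_cancel, map_one]; rfl)
  rw [h1] at h2
  rw [map_mul, map_mul, functionEnd_mul_apply, functionEnd_mul_apply, h1, hs,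
    signedConjHom_apply]
  rw [signedConjHom_apply] at h2
  have h3 := congrArg Prod.snd h2
  simp only at h3
  ext
  · rfl
  · simp only
    linear_combination h3

/-- **Strong exchange property**: if `t` is a left inversion of the product of a word (reduced or
not), then multiplying by `t` amounts to erasing a letter. -/
theorem exists_eraseIdx_of_isLeftInversion {ω : List B} {t : W}
    (ht : cs.IsLeftInversion (cs.wordProd ω) t) :
    ∃ j < ω.length, t * cs.wordProd ω = cs.wordProd (ω.eraseIdx j) := by
  classical
  obtain ⟨hrefl, hlt⟩ := ht
  have hmem : t ∈ cs.leftInvSeq ω := by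
    by_contra hnot
    set w := cs.wordProd ω with hw
    -- The parity of `t` at `w` would be even, hence odd at `t * w`.
    have h1 : signedConjHom cs (t * w) (w⁻¹ * t * w, 0) = (t, 1) := by
      rw [map_mul, functionEnd_mul_apply, hw, signedConjHom_wordProd, ← hw,
        show w * (w⁻¹ * t * w) * w⁻¹ = t by group, List.count_eq_zero_of_not_mem hnot,
        signedConjHom_reflection cs hrefl]
      simp
    obtain ⟨ω', hred, hω'⟩ := cs.exists_isReduced (t * w)
    rw [hω', signedConjHom_wordProd, ← hω',
      show t * w * (w⁻¹ * t * w) * (t * w)⁻¹ = t by group] at h1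
    have h2 : t ∈ cs.leftInvSeq ω' := by
      by_contra hnot'
      simp [List.count_eq_zero_of_not_mem hnot'] at h1
    have h3 := (cs.isLeftInversion_of_mem_leftInvSeq hred h2).2
    rw [← hω', ← mul_assoc, hrefl.mul_self, one_mul] at h3
    omega
  obtain ⟨j, hj, rfl⟩ := List.mem_iff_getElem.mp hmem
  refine ⟨j, by simpa using hj, ?_⟩
  rw [← List.getD_eq_getElem _ 1 hj, cs.getD_leftInvSeq_mul_wordProd]

/-- **Deletion property**: every word contains a reduced word with the same product. -/
theorem exists_isReduced_sublist (ω : List B) :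
    ∃ ω' : List B, ω'.Sublist ω ∧ cs.IsReduced ω' ∧ cs.wordProd ω' = cs.wordProd ω := by
  induction ω with
  | nil => exact ⟨[], List.Sublist.slnil, by simp [CoxeterSystem.IsReduced], rfl⟩
  | cons i ω ih =>
    obtain ⟨ω', hsub, hred, hprod⟩ := ih
    rcases cs.length_simple_mul (cs.wordProd ω') i with hl | hl
    · refine ⟨i :: ω', hsub.cons_cons i, ?_, by rw [cs.wordProd_cons, cs.wordProd_cons, hprod]⟩
      rw [CoxeterSystem.IsReduced, cs.wordProd_cons, hl, hred.eq, List.length_cons]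
    · obtain ⟨j, hj, he⟩ := exists_eraseIdx_of_isLeftInversion cs (ω := ω') (t := cs.simple i)
        ⟨cs.isReflection_simple i, by omega⟩
      refine ⟨ω'.eraseIdx j, ((List.eraseIdx_sublist _ _).trans hsub).cons i, ?_, ?_⟩
      · rw [CoxeterSystem.IsReduced, ← he, List.length_eraseIdx_of_lt hj]
        have := hred.eq
        omega
      · rw [← he, cs.wordProd_cons, hprod]

/-! ### The Bruhat order -/

/-- `v = tu` for a reflection `t` with `ℓ(u) < ℓ(v)`. The Bruhat order is the reflexive transitive
closure of this relation. -/
def ReflectionStep (u v : W) : Prop :=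
  ∃ t, cs.IsReflection t ∧ v = t * u ∧ cs.length u < cs.length v

variable {cs}

/-- If `u ≤ v`, then `u` is the product of a subword of every word for `v`, and not only of some
reduced word. -/
theorem exists_sublist_of_reflTransGen {u v : W}
    (h : Relation.ReflTransGen (ReflectionStep cs) u v) :
    ∀ ω : List B, cs.wordProd ω = v → ∃ ω' : List B, ω'.Sublist ω ∧ cs.wordProd ω' = u := by
  induction h with
  | refl => exact fun ω hω => ⟨ω, List.Sublist.refl _, hω⟩
  | @tail v' v _ hstep ih =>
    rintro ω rfl
    obtain ⟨t, ht, hv, hl⟩ := hstep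
    have hv' : t * cs.wordProd ω = v' := by rw [hv, ← mul_assoc, ht.mul_self, one_mul]
    obtain ⟨j, -, hj⟩ := exists_eraseIdx_of_isLeftInversion cs (ω := ω) (t := t)
      ⟨ht, by rwa [hv']⟩
    obtain ⟨ω', hsub, hω'⟩ := ih (ω.eraseIdx j) (by rw [← hj, hv'])
    exact ⟨ω', hsub.trans (List.eraseIdx_sublist _ _), hω'⟩

theorem reflectionStep_simple {v : W} {i : B} (h : cs.length v ≤ cs.length (cs.simple i * v)) :
    ReflectionStep cs v (cs.simple i * v) :=
  ⟨_, cs.isReflection_simple i, rfl, lt_of_le_of_ne h (cs.length_simple_mul_ne v i).symm⟩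

theorem reflTransGen_simple_mul {u v : W} (h : Relation.ReflTransGen (ReflectionStep cs) u v)
    (i : B) :
    Relation.ReflTransGen (ReflectionStep cs) (cs.simple i * u) (cs.simple i * v) ∨
      Relation.ReflTransGen (ReflectionStep cs) (cs.simple i * u) v := by
  induction h with
  | refl => exact Or.inl .refl
  | @tail v' v h hstep ih =>
    rcases ih with ih | ih
    swap
    · exact Or.inr (ih.tail hstep)
    obtain ⟨t, ht, hv, hl⟩ := hstep
    have hconj : cs.IsReflection (cs.simple i * t * (cs.simple i)⁻¹) := ht.conj _
    have hsv : cs.simple i * v = cs.simple i * t * (cs.simple i)⁻¹ * (cs.simple i * v') := by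
      rw [hv]; group
    have hne : cs.length (cs.simple i * v) ≠ cs.length (cs.simple i * v') := by
      rw [hsv]; exact hconj.length_mul_right_ne _
    rcases lt_or_gt_of_ne hne.symm with hlt | hgt
    · exact Or.inl (ih.tail ⟨_, hconj, hsv, hlt⟩)
    · -- Here `v` covers `v'` and has `s_i` as a left descent while `v'` has not; exchange then
      -- forces `v = s_i * v'`.
      right
      have h1 := cs.length_simple_mul v i
      have h2 := cs.length_simple_mul v' i
      obtain ⟨ω, hred, hω⟩ := cs.exists_isReduced (cs.simple i * v)
      have hv2 : v = cs.wordProd (i :: ω) := by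
        rw [cs.wordProd_cons, ← hω, cs.simple_mul_simple_cancel_left]
      have hv' : t * v = v' := by rw [hv, ← mul_assoc, ht.mul_self, one_mul]
      obtain ⟨j, hj, he⟩ := exists_eraseIdx_of_isLeftInversion cs (ω := i :: ω) (t := t)
        ⟨ht, by rw [← hv2, hv']; exact hl⟩
      rw [← hv2, hv'] at he
      rcases j with _ | j
      · rw [List.eraseIdx_cons_zero, ← hω] at he
        rwa [he, cs.simple_mul_simple_cancel_left] at ih
      · exfalso
        rw [List.eraseIdx_cons_succ, cs.wordProd_cons] at he
        have h3 := cs.length_wordProd_le (ω.eraseIdx j)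
        rw [List.length_eraseIdx_of_lt (by simpa using hj), ← hred.eq, ← hω,
          ← cs.simple_mul_simple_cancel_left (w := cs.wordProd (ω.eraseIdx j)) i, ← he] at h3
        omega

/-- A subword of a reduced word, itself reduced or not, has a smaller product. -/
theorem reflTransGen_of_sublist {ω ω' : List B} (hsub : ω'.Sublist ω) :
    cs.IsReduced ω →
      Relation.ReflTransGen (ReflectionStep cs) (cs.wordProd ω') (cs.wordProd ω) := by
  induction hsub with
  | slnil => exact fun _ => .refl
  | @cons ω' ω i hsub ih =>
    intro hred
    have hred' : cs.IsReduced ω := hred.drop 1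
    have h1 := hred.eq
    rw [cs.wordProd_cons, List.length_cons, ← hred'.eq] at h1
    rw [cs.wordProd_cons]
    exact (ih hred').tail (reflectionStep_simple (by omega))
  | @cons_cons ω' ω i hsub ih =>
    intro hred
    have hred' : cs.IsReduced ω := hred.drop 1
    have h1 := hred.eq
    rw [cs.wordProd_cons, List.length_cons, ← hred'.eq] at h1
    rw [cs.wordProd_cons, cs.wordProd_cons]
    rcases reflTransGen_simple_mul (ih hred') i with h | h
    · exact h
    · exact h.tail (reflectionStep_simple (by omega))

theorem bruhatLE_iff_reflTransGen {u v : W} :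
    BruhatLE cs u v ↔ Relation.ReflTransGen (ReflectionStep cs) u v := by
  constructor
  · rintro ⟨ω, hred, rfl, ω', hsub, -, rfl⟩
    exact reflTransGen_of_sublist hsub hred
  · intro h
    obtain ⟨ω, hred, hω⟩ := cs.exists_isReduced v
    obtain ⟨ω', hsub, hω'⟩ := exists_sublist_of_reflTransGen h ω hω.symm
    obtain ⟨ω'', hsub', hred', hω''⟩ := exists_isReduced_sublist cs ω'
    exact ⟨ω, hred, hω.symm, ω'', hsub'.trans hsub, hred', hω''.trans hω'⟩

namespace BruhatLE

theorem refl (u : W) : BruhatLE cs u u := bruhatLE_iff_reflTransGen.2 .refl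

theorem trans {u v w : W} (h : BruhatLE cs u v) (h' : BruhatLE cs v w) : BruhatLE cs u w :=
  bruhatLE_iff_reflTransGen.2
    ((bruhatLE_iff_reflTransGen.1 h).trans (bruhatLE_iff_reflTransGen.1 h'))

theorem antisymm {u v : W} (h : BruhatLE cs u v) (h' : BruhatLE cs v u) : u = v := by
  obtain ⟨ω, hω, rfl, ω', hsub, hω', rfl⟩ := h
  obtain ⟨ω₁, hω₁, h1, ω₂, hsub', hω₂, h2⟩ := h'
  have e1 : ω₁.length = ω'.length := by rw [← hω₁.eq, h1, hω'.eq]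
  have e2 : ω₂.length = ω.length := by rw [← hω₂.eq, h2, hω.eq]
  rw [hsub.eq_of_length_le (by have := hsub'.length_le; omega)]

theorem length_le {u v : W} (h : BruhatLE cs u v) : cs.length u ≤ cs.length v := by
  obtain ⟨ω, hω, rfl, ω', hsub, hω', rfl⟩ := h
  rw [hω.eq, hω'.eq]
  exact hsub.length_le

theorem inv {u v : W} (h : BruhatLE cs u v) : BruhatLE cs u⁻¹ v⁻¹ := by
  obtain ⟨ω, hω, rfl, ω', hsub, hω', rfl⟩ := h
  exact ⟨ω.reverse, hω.reverse, cs.wordProd_reverse ω, ω'.reverse, hsub.reverse, hω'.reverse,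
    cs.wordProd_reverse ω'⟩

theorem one_le (v : W) : BruhatLE cs 1 v := by
  obtain ⟨ω, hred, hω⟩ := cs.exists_isReduced v
  exact ⟨ω, hred, hω.symm, [], List.nil_sublist _, by simp [CoxeterSystem.IsReduced], by simp⟩

theorem eq_one {u : W} (h : BruhatLE cs u 1) : u = 1 := h.antisymm (one_le u)

theorem simple_mul_self {v : W} {i : B} (h : cs.length v ≤ cs.length (cs.simple i * v)) :
    BruhatLE cs v (cs.simple i * v) :=
  bruhatLE_iff_reflTransGen.2 (.single (reflectionStep_simple h))

/-- The lifting property: if `u ≤ v`, then `su ≤ max (v, sv)`. -/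
theorem simple_mul_or {u v : W} (h : BruhatLE cs u v) (i : B) :
    BruhatLE cs (cs.simple i * u) (cs.simple i * v) ∨ BruhatLE cs (cs.simple i * u) v := by
  simpa only [bruhatLE_iff_reflTransGen] using
    reflTransGen_simple_mul (bruhatLE_iff_reflTransGen.1 h) i

/-- The lifting property: if `u ≤ v`, then `min (u, su) ≤ sv`. -/
theorem simple_mul_or' {u v : W} (h : BruhatLE cs u v) (i : B) :
    BruhatLE cs (cs.simple i * u) (cs.simple i * v) ∨ BruhatLE cs u (cs.simple i * v) := by
  by_cases hl : cs.length v ≤ cs.length (cs.simple i * v)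
  · exact Or.inr (h.trans (simple_mul_self hl))
  · obtain ⟨ω, hred, hω⟩ := cs.exists_isReduced (cs.simple i * v)
    have hv : cs.wordProd (i :: ω) = v := by
      rw [cs.wordProd_cons, ← hω, cs.simple_mul_simple_cancel_left]
    obtain ⟨ω', hsub, rfl⟩ :=
      exists_sublist_of_reflTransGen (bruhatLE_iff_reflTransGen.1 h) (i :: ω) hv
    rw [hω]
    cases hsub with
    | cons _ hsub =>
      exact Or.inr (bruhatLE_iff_reflTransGen.2 (reflTransGen_of_sublist hsub hred))
    | cons_cons _ hsub =>
      left
      rw [cs.wordProd_cons, cs.simple_mul_simple_cancel_left]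
      exact bruhatLE_iff_reflTransGen.2 (reflTransGen_of_sublist hsub hred)

/-- Left multiplication by a simple reflection that lengthens the larger element is monotone. -/
theorem simple_mul {u v : W} (h : BruhatLE cs u v) {i : B}
    (hl : cs.length v ≤ cs.length (cs.simple i * v)) :
    BruhatLE cs (cs.simple i * u) (cs.simple i * v) :=
  (h.simple_mul_or i).elim id fun h' => h'.trans (simple_mul_self hl)

end BruhatLE

end Bruhat

section Cosets

variable {B : Type*} {M : CoxeterMatrix B} {W : Type*} [Group W] {cs : CoxeterSystem M W}
  {I : Set B}

/-! ### Parabolic subgroups and minimal coset representatives -/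

theorem simple_mem_parabolic {i : B} (hi : i ∈ I) : cs.simple i ∈ parabolic cs I :=
  Subgroup.subset_closure ⟨i, hi, rfl⟩

theorem parabolic_mono {J : Set B} (h : I ⊆ J) : parabolic cs I ≤ parabolic cs J :=
  Subgroup.closure_mono (Set.image_mono h)

theorem parabolic_empty : parabolic cs ∅ = ⊥ := by simp [parabolic]

theorem wordProd_mem_parabolic {ω : List B} (h : ∀ i ∈ ω, i ∈ I) :
    cs.wordProd ω ∈ parabolic cs I := by
  induction ω with
  | nil => simp
  | cons i ω ih =>
    rw [List.forall_mem_cons] at h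
    rw [cs.wordProd_cons]
    exact mul_mem (simple_mem_parabolic h.1) (ih h.2)

theorem exists_word_of_mem_parabolic {w : W} (hw : w ∈ parabolic cs I) :
    ∃ ω : List B, (∀ i ∈ ω, i ∈ I) ∧ cs.wordProd ω = w := by
  induction hw using Subgroup.closure_induction with
  | mem x hx =>
    obtain ⟨i, hi, rfl⟩ := hx
    exact ⟨[i], by simpa using hi, by simp⟩
  | one => exact ⟨[], by simp, by simp⟩
  | mul x y _ _ hx hy =>
    obtain ⟨ω, h, rfl⟩ := hx
    obtain ⟨ω', h', rfl⟩ := hy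
    refine ⟨ω ++ ω', fun i hi => ?_, cs.wordProd_append _ _⟩
    exact (List.mem_append.1 hi).elim (h i) (h' i)
  | inv x _ hx =>
    obtain ⟨ω, h, rfl⟩ := hx
    exact ⟨ω.reverse, fun i hi => h i (List.mem_reverse.1 hi), cs.wordProd_reverse ω⟩

theorem exists_isReduced_of_mem_parabolic {w : W} (hw : w ∈ parabolic cs I) :
    ∃ ω : List B, (∀ i ∈ ω, i ∈ I) ∧ cs.IsReduced ω ∧ cs.wordProd ω = w := by
  obtain ⟨ω, h, rfl⟩ := exists_word_of_mem_parabolic hw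
  obtain ⟨ω', hsub, hred, hω'⟩ := exists_isReduced_sublist cs ω
  exact ⟨ω', fun i hi => h i (hsub.subset hi), hred, hω'⟩

theorem parabolic_induction_left {p : W → Prop} {w : W} (hw : w ∈ parabolic cs I) (one : p 1)
    (simple_mul : ∀ i ∈ I, ∀ q ∈ parabolic cs I, p q → p (cs.simple i * q)) : p w := by
  obtain ⟨ω, h, rfl⟩ := exists_word_of_mem_parabolic hw
  clear hw
  induction ω with
  | nil => simpa using one
  | cons i ω ih =>
    rw [List.forall_mem_cons] at h
    rw [cs.wordProd_cons]
    exact simple_mul i h.1 _ (wordProd_mem_parabolic h.2) (ih h.2)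

theorem mem_minLeftReps {u : W} :
    u ∈ minLeftReps cs I ↔ ∀ a ∈ parabolic cs I, BruhatLE cs u (a * u) := by
  simp [minLeftReps, minReps, parabolic_empty]

theorem mem_minRightReps_iff_inv {u : W} :
    u ∈ minRightReps cs I ↔ u⁻¹ ∈ minLeftReps cs I := by
  have h : u ∈ minRightReps cs I ↔ ∀ b ∈ parabolic cs I, BruhatLE cs u (u * b) := by
    simp [minRightReps, minReps, parabolic_empty]
  rw [h, mem_minLeftReps]
  constructor
  · intro h a ha
    simpa using (h a⁻¹ (inv_mem ha)).inv
  · intro h b hb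
    simpa using (h b⁻¹ (inv_mem hb)).inv

theorem minLeftReps_anti {J : Set B} (h : I ⊆ J) : minLeftReps cs J ⊆ minLeftReps cs I :=
  fun _ hu => mem_minLeftReps.2 fun a ha => mem_minLeftReps.1 hu a (parabolic_mono h ha)

theorem one_mem_minLeftReps : (1 : W) ∈ minLeftReps cs I :=
  mem_minLeftReps.2 fun _ _ => BruhatLE.one_le _

theorem eq_of_mem_minLeftReps {u v a : W} (hu : u ∈ minLeftReps cs I) (hv : v ∈ minLeftReps cs I)
    (ha : a ∈ parabolic cs I) (h : v = a * u) : u = v := by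
  refine (h ▸ mem_minLeftReps.1 hu a ha).antisymm ?_
  have := mem_minLeftReps.1 hv a⁻¹ (inv_mem ha)
  rwa [h, inv_mul_cancel_left, ← h] at this

/-- Passing to cosets of a parabolic subgroup is monotone for the Bruhat order. -/
theorem BruhatLE.exists_parabolic_mul {z z' p : W} (h : BruhatLE cs z z')
    (hp : p ∈ parabolic cs I) : ∃ q ∈ parabolic cs I, BruhatLE cs (q * z) (p * z') := by
  refine parabolic_induction_left
    (p := fun p => ∃ q ∈ parabolic cs I, BruhatLE cs (q * z) (p * z')) hp
    ⟨1, one_mem _, by simpa using h⟩ ?_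
  rintro i hi p - ⟨q, hq, hle⟩
  rcases hle.simple_mul_or' i with h' | h'
  · exact ⟨_, mul_mem (simple_mem_parabolic hi) hq, by simpa only [mul_assoc] using h'⟩
  · exact ⟨q, hq, by simpa only [mul_assoc] using h'⟩

theorem BruhatLE.parabolic_mul {y z p : W} (h : BruhatLE cs y z) (hy : y ∈ minLeftReps cs I)
    (hp : p ∈ parabolic cs I) : BruhatLE cs y (p * z) := by
  obtain ⟨q, hq, hle⟩ := h.exists_parabolic_mul hp
  exact (mem_minLeftReps.1 hy q hq).trans hle

theorem exists_minLeftReps (I : Set B) (w : W) :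
    ∃ a ∈ parabolic cs I, ∃ y ∈ minLeftReps cs I, w = a * y := by
  classical
  -- An element of minimal length in the coset is minimal for the Bruhat order.
  have hex : ∃ n, ∃ a ∈ parabolic cs I, cs.length (a * w) = n := ⟨_, 1, one_mem _, rfl⟩
  obtain ⟨a, ha, hlen⟩ := Nat.find_spec hex
  have hmin : ∀ c ∈ parabolic cs I, cs.length (a * w) ≤ cs.length (c * (a * w)) := by
    intro c hc
    rw [hlen]
    exact Nat.find_min' hex ⟨c * a, mul_mem hc ha, by rw [mul_assoc]⟩
  refine ⟨a⁻¹, inv_mem ha, a * w, mem_minLeftReps.2 fun c hc => ?_, by simp⟩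
  refine parabolic_induction_left (p := fun c => BruhatLE cs (a * w) (c * (a * w))) hc
    (by simpa using BruhatLE.refl _) ?_
  intro i hi c _ hle
  rw [mul_assoc]
  rcases hle.simple_mul_or' i with h | h
  · exact (BruhatLE.simple_mul_self (hmin _ (simple_mem_parabolic hi))).trans h
  · exact h

theorem length_mul_of_mem_minLeftReps {y a : W} (hy : y ∈ minLeftReps cs I)
    (ha : a ∈ parabolic cs I) : cs.length (a * y) = cs.length a + cs.length y := by
  refine le_antisymm (cs.length_mul_le a y) ?_
  obtain ⟨α, hα, hαred, rfl⟩ := exists_isReduced_of_mem_parabolic ha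
  obtain ⟨β, hβ, rfl⟩ := cs.exists_isReduced y
  obtain ⟨γ, hsub, hγ, hprod⟩ := exists_isReduced_sublist cs (α ++ β)
  obtain ⟨α', β', rfl, hα', hβ'⟩ := List.sublist_append_iff.1 hsub
  rw [cs.wordProd_append, cs.wordProd_append] at hprod
  -- By minimality of `y`, no letter of `β` is deleted; then none of `α` is.
  have hα'mem : cs.wordProd α' ∈ parabolic cs I :=
    wordProd_mem_parabolic fun i hi => hα i (hα'.subset hi)
  have h1 : cs.length (cs.wordProd β) ≤ cs.length (cs.wordProd β') := by
    have h2 : cs.wordProd β' = (cs.wordProd α')⁻¹ * cs.wordProd α * cs.wordProd β := by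
      rw [mul_assoc, ← hprod, inv_mul_cancel_left]
    rw [h2]
    exact (mem_minLeftReps.1 hy _ (mul_mem (inv_mem hα'mem) ha)).length_le
  have hββ' : β' = β := by
    refine hβ'.eq_of_length_le ?_
    rw [← hβ.eq]
    exact h1.trans (cs.length_wordProd_le _)
  subst hββ'
  have hαα' := mul_right_cancel hprod
  have h3 := cs.length_wordProd_le α'
  rw [hαα'] at h3
  rw [← hprod, ← cs.wordProd_append, hγ.eq, List.length_append, hβ.eq]
  omega

/-- Left multiplications of two Bruhat inequalities by elements of `W_I` can be adapted
simultaneously, provided the larger element of one of them is minimal in its coset. -/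
theorem BruhatLE.exists_parabolic_mul_pair {α α' d y p : W} (h : BruhatLE cs α α')
    (hd : BruhatLE cs d y) (hy : y ∈ minLeftReps cs I) (hp : p ∈ parabolic cs I) :
    ∃ p' ∈ parabolic cs I, BruhatLE cs (p * α) (p' * α') ∧ BruhatLE cs (p' * d) (p * y) := by
  obtain ⟨ω, hω, hred, rfl⟩ := exists_isReduced_of_mem_parabolic hp
  clear hp
  induction ω with
  | nil => exact ⟨1, one_mem _, by simpa using h, by simpa using hd⟩
  | cons i ω ih =>
    rw [List.forall_mem_cons] at hω
    have hred' : cs.IsReduced ω := hred.drop 1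
    obtain ⟨q, hq, hqα, hqd⟩ := ih hω.2 hred'
    have hlen : cs.length (cs.wordProd ω * y) ≤ cs.length (cs.simple i * (cs.wordProd ω * y)) := by
      rw [← mul_assoc, ← cs.wordProd_cons,
        length_mul_of_mem_minLeftReps hy (wordProd_mem_parabolic hω.2),
        length_mul_of_mem_minLeftReps hy (wordProd_mem_parabolic (List.forall_mem_cons.2 hω)),
        hred.eq, hred'.eq, List.length_cons]
      omega
    rw [cs.wordProd_cons, mul_assoc, mul_assoc]
    rcases hqα.simple_mul_or i with h' | h'
    · refine ⟨cs.simple i * q, mul_mem (simple_mem_parabolic hω.1) hq, ?_, ?_⟩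
      · rwa [mul_assoc]
      · rw [mul_assoc]
        exact hqd.simple_mul hlen
    · exact ⟨q, hq, h', hqd.trans (BruhatLE.simple_mul_self hlen)⟩

theorem length_simple_mul_of_not_mem_parabolic {i : B} (hi : cs.simple i ∉ parabolic cs I) {p : W}
    (hp : p ∈ parabolic cs I) : cs.length (cs.simple i * p) = cs.length p + 1 := by
  refine (cs.length_simple_mul p i).resolve_right fun hlt => hi ?_
  obtain ⟨ω, hω, rfl⟩ := exists_word_of_mem_parabolic hp
  obtain ⟨j, -, hj⟩ := exists_eraseIdx_of_isLeftInversion cs (ω := ω)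
    (t := cs.simple i) ⟨cs.isReflection_simple i, by omega⟩
  rw [eq_mul_inv_of_mul_eq hj]
  exact mul_mem (wordProd_mem_parabolic fun i hi => hω i (List.mem_of_mem_eraseIdx hi)) (inv_mem hp)

/-- A simple reflection outside `W_I` that conjugates `s_j ∈ W_I` into `W_I` commutes
with `s_j`. -/
theorem simple_commute_of_conj_mem {i j : B} (hi : cs.simple i ∉ parabolic cs I)
    (hj : cs.simple j ∈ parabolic cs I)
    (hconj : cs.simple i * cs.simple j * cs.simple i ∈ parabolic cs I) :
    cs.simple i * cs.simple j = cs.simple j * cs.simple i := by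
  have h1 := length_simple_mul_of_not_mem_parabolic hi hconj
  have h2 := cs.length_mul_le (cs.simple j) (cs.simple i)
  rw [mul_assoc, cs.simple_mul_simple_cancel_left, ← mul_assoc] at h1
  have h3 := length_simple_mul_of_not_mem_parabolic hi hj
  have h4 := cs.length_mul_simple (cs.simple i * cs.simple j) i
  rw [cs.length_simple] at h2 h3
  rw [cs.length_simple] at h2
  have h5 : cs.length (cs.simple i * cs.simple j * cs.simple i) = 1 := by omega
  obtain ⟨k, hk⟩ := cs.length_eq_one_iff.1 h5
  -- Now `s_i s_j = s_k s_i`; exchanging `s_i` in the word `s_k s_i` gives `s_j = s_k`.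
  have hki : cs.wordProd [k, i] = cs.simple i * cs.simple j := by
    rw [cs.wordProd_cons, cs.wordProd_singleton, ← hk, cs.simple_mul_simple_cancel_right]
  obtain ⟨l, hl, he⟩ := exists_eraseIdx_of_isLeftInversion cs (ω := [k, i]) (t := cs.simple i)
    ⟨cs.isReflection_simple i, by
      rw [hki, cs.simple_mul_simple_cancel_left, cs.length_simple]; omega⟩
  rw [hki, cs.simple_mul_simple_cancel_left] at he
  match l, hl with
  | 0, _ => exact absurd (by simpa [he] using hj) hi
  | 1, _ =>
    have hjk : cs.simple j = cs.simple k := by simpa using he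
    rw [← hki, hjk, cs.wordProd_cons, cs.wordProd_singleton]

end Cosets

section Factorizable

variable {R : Type*} [Monoid R]

/-! ### Factorizable monoids -/

theorem mem_commSubgroup {e : R} {w : Rˣ} : w ∈ commSubgroup e ↔ (w : R) * e = e * w := Iff.rfl

theorem fixSubgroup_le_commSubgroup (e : R) : fixSubgroup e ≤ commSubgroup e :=
  fun _ hw => hw.1.trans hw.2.symm

theorem IdemLE.antisymm {e f : R} (h : IdemLE e f) (h' : IdemLE f e) : e = f :=
  h.1.symm.trans h'.2

theorem IdemLE.trans {e f g : R} (h : IdemLE e f) (h' : IdemLE f g) : IdemLE e g :=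
  ⟨by rw [← h.1, mul_assoc, h'.1], by rw [← h.2, ← mul_assoc, h'.2]⟩

theorem IdemLE.refl {e : R} (he : IsIdempotentElem e) : IdemLE e e := ⟨he, he⟩

theorem IdemLE.conj {e f : R} (h : IdemLE e f) (w : Rˣ) :
    IdemLE (w * e * ↑w⁻¹) (w * f * ↑w⁻¹) := by
  have key (e f : R) : (w * e * ↑w⁻¹ : R) * (w * f * ↑w⁻¹) = w * (e * f) * ↑w⁻¹ := by
    simp [mul_assoc]
  exact ⟨by rw [key, h.1], by rw [key, h.2]⟩

theorem isIdempotentElem_conj {e : R} (he : IsIdempotentElem e) (w : Rˣ) :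
    IsIdempotentElem (w * e * ↑w⁻¹ : R) := ((IdemLE.refl he).conj w).1

theorem conj_eq_iff_mul_eq_mul {e f : R} {w : Rˣ} :
    (w * e * ↑w⁻¹ : R) = f ↔ (w : R) * e = f * w := Units.mul_inv_eq_iff_eq_mul w

theorem conj_eq_self_of_mem {e : R} {w : Rˣ} (hw : w ∈ commSubgroup e) :
    (w * e * ↑w⁻¹ : R) = e := conj_eq_iff_mul_eq_mul.2 hw

theorem lowerTypeMap_anti {B : Type*} {M : CoxeterMatrix B} (cs : CoxeterSystem M Rˣ) {e f : R}
    (h : IdemLE e f) : lowerTypeMap cs f ⊆ lowerTypeMap cs e := by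
  rintro i ⟨h1, h2⟩
  exact ⟨by rw [← h.2, ← mul_assoc, h1], by rw [← h.1, mul_assoc, h2]⟩

namespace IsFactorizable

variable (hR : IsFactorizable R)
include hR

theorem idem_eq_of_mul_unit_eq {e f : R} (he : IsIdempotentElem e) (hf : IsIdempotentElem f)
    {u v : Rˣ} (h : e * u = f * v) : e = f := by
  have h1 : f * e = e := by
    rw [Units.eq_mul_inv_iff_mul_eq u |>.2 h, ← mul_assoc, ← mul_assoc, hf.eq]
  have h2 : e * f = f := by
    rw [Units.eq_mul_inv_iff_mul_eq v |>.2 h.symm, ← mul_assoc, ← mul_assoc, he.eq]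
  rw [← h1, ← hR.idem_comm e f he hf, h2]

theorem mem_fixSubgroup_of_idem_mul_eq {e : R} (he : IsIdempotentElem e) {w : Rˣ}
    (h : e * w = e) : w ∈ fixSubgroup e := by
  refine ⟨?_, h⟩
  have h1 : (w * e * ↑w⁻¹ : R) = w * e := by
    rw [mul_assoc, ← Units.eq_mul_inv_iff_mul_eq w |>.2 h]
  have h2 := hR.idem_comm _ _ he (isIdempotentElem_conj he w)
  rw [h1, ← mul_assoc, h, he.eq, mul_assoc, he.eq] at h2
  exact h2.symm

end IsFactorizable

end Factorizable

namespace IsGenRennerCoxeterSystem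

variable {R : Type*} [Monoid R] {B : Type*} {M : CoxeterMatrix B} {cs : CoxeterSystem M Rˣ}
  {Λ : Set R} (h : IsGenRennerCoxeterSystem cs Λ)
include h

/-! ### The centralizer of an idempotent -/

theorem simple_mem_fix_iff {e : R} (he : e ∈ Λ) {i : B} :
    cs.simple i ∈ parabolic cs (lowerTypeMap cs e) ↔ i ∈ lowerTypeMap cs e := by
  rw [h.parabolic_lowerTypeMap cs he]; rfl

theorem parabolic_upper_le_commSubgroup {e : R} (he : e ∈ Λ) :
    parabolic cs (upperTypeMap cs e) ≤ commSubgroup e := by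
  rw [← h.parabolic_typeMap cs he]
  exact parabolic_mono fun _ hi => hi.1

theorem parabolic_lower_le_commSubgroup {e : R} (he : e ∈ Λ) :
    parabolic cs (lowerTypeMap cs e) ≤ commSubgroup e := by
  rw [h.parabolic_lowerTypeMap cs he]
  exact fixSubgroup_le_commSubgroup e

/-- `W_{λ_*(e)}` is normal in the centralizer of `e`, which forces the generators in `λ^*(e)` to
commute with those in `λ_*(e)`. -/
theorem upper_mul_lower_comm {e : R} (he : e ∈ Λ) {p q : Rˣ}
    (hp : p ∈ parabolic cs (upperTypeMap cs e)) (hq : q ∈ parabolic cs (lowerTypeMap cs e)) :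
    p * q = q * p := by
  have key : ∀ i ∈ upperTypeMap cs e, ∀ j ∈ lowerTypeMap cs e,
      Commute (cs.simple i) (cs.simple j) := by
    intro i hi j hj
    refine simple_commute_of_conj_mem (I := lowerTypeMap cs e) ?_ (simple_mem_parabolic hj) ?_
    · rw [h.simple_mem_fix_iff he]
      exact fun hi' => hi.2 hi'.2
    · rw [h.parabolic_lowerTypeMap cs he]
      have hi1 : (cs.simple i : R) * e = e * cs.simple i := hi.1
      have hj1 : (cs.simple j : R) * e = e := hj.1
      have hii : (cs.simple i : R) * cs.simple i = 1 := by
        rw [← Units.val_mul, cs.simple_mul_simple_self, Units.val_one]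
      refine h.factorizable.mem_fixSubgroup_of_idem_mul_eq (h.idem_of_mem e he) ?_
      have hj2 : e * (cs.simple j : R) = e := hj.2
      rw [Units.val_mul, Units.val_mul, ← mul_assoc, ← mul_assoc, ← hi1, mul_assoc _ e, hj2, hi1,
        mul_assoc, hii, mul_one]
  have hsimple : ∀ i ∈ upperTypeMap cs e, Commute (cs.simple i) q := fun i hi =>
    parabolic_induction_left (p := fun q => Commute (cs.simple i) q) hq (Commute.one_right _)
      fun j hj _ _ hq => (key i hi j hj).mul_right hq
  exact parabolic_induction_left (p := fun p => Commute p q) hp (Commute.one_left _)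
    fun i hi _ _ hp => (hsimple i hi).mul_left hp

theorem exists_upper_mul_lower {e : R} (he : e ∈ Λ) {c : Rˣ} (hc : c ∈ commSubgroup e) :
    ∃ p ∈ parabolic cs (upperTypeMap cs e), ∃ q ∈ parabolic cs (lowerTypeMap cs e), c = p * q := by
  rw [← h.parabolic_typeMap cs he] at hc
  refine parabolic_induction_left (p := fun c => ∃ p ∈ parabolic cs (upperTypeMap cs e),
    ∃ q ∈ parabolic cs (lowerTypeMap cs e), c = p * q) hc
    ⟨1, one_mem _, 1, one_mem _, (mul_one 1).symm⟩ ?_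
  rintro i hi _ - ⟨p, hp, q, hq, rfl⟩
  by_cases hi' : e * (cs.simple i : R) = e
  · have hs : cs.simple i ∈ parabolic cs (lowerTypeMap cs e) :=
      simple_mem_parabolic ⟨hi.trans hi', hi'⟩
    refine ⟨p, hp, cs.simple i * q, mul_mem hs hq, ?_⟩
    rw [← mul_assoc, ← mul_assoc, h.upper_mul_lower_comm he hp hs]
  · exact ⟨cs.simple i * p, mul_mem (simple_mem_parabolic ⟨hi, hi'⟩) hp, q, hq,
      (mul_assoc _ _ _).symm⟩

/-! ### Existence and uniqueness of standard forms -/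

theorem eq_of_conj {E e f : R} (hE : IsIdempotentElem E) (he : e ∈ Λ) (hf : f ∈ Λ) {u v : Rˣ}
    (hu : (u * E * ↑u⁻¹ : R) = e) (hv : (v * E * ↑v⁻¹ : R) = f) : e = f :=
  (h.transversal E hE).unique ⟨he, u, hu⟩ ⟨hf, v, hv⟩

theorem exists_isLeftStandardForm (r : R) : ∃ x e y, IsLeftStandardForm cs Λ r x e y := by
  obtain ⟨E, hE, u, rfl⟩ := h.factorizable.exists_idem_mul_unit r
  obtain ⟨e, ⟨he, w, hw⟩, -⟩ := h.transversal E hE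
  obtain ⟨c, hc, y, hy, hcy⟩ := exists_minLeftReps (cs := cs) (typeMap cs e) (w * u)
  rw [h.parabolic_typeMap cs he] at hc
  obtain ⟨d, hd, x, hx, hdx⟩ := exists_minLeftReps (cs := cs) (lowerTypeMap cs e) (c⁻¹ * w)
  rw [h.parabolic_lowerTypeMap cs he] at hd
  refine ⟨x⁻¹, e, y, ?_, he, mem_minRightReps_iff_inv.2 (by rwa [inv_inv]), hy⟩
  have hx' : x⁻¹ = w⁻¹ * c * d := by
    rw [eq_comm, ← inv_inj, inv_inv, eq_comm, ← inv_mul_cancel_left d x, ← hdx]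
    group
  have hu : u = w⁻¹ * (c * y) := by rw [← hcy, inv_mul_cancel_left]
  have hE' : E * ↑w⁻¹ = ↑w⁻¹ * e := by
    rw [← hw]; simp [mul_assoc]
  rw [hx', hu, Units.val_mul, Units.val_mul, Units.val_mul, Units.val_mul, ← mul_assoc, hE',
    mul_assoc _ (d : R), hd.1, mul_assoc _ (c : R), mem_commSubgroup.1 hc]
  simp only [mul_assoc]

theorem isLeftStandardForm_unique {r : R} {x y a b : Rˣ} {e f : R}
    (hr : IsLeftStandardForm cs Λ r x e y) (hs : IsLeftStandardForm cs Λ r a f b) :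
    x = a ∧ e = f ∧ y = b := by
  obtain ⟨rfl, he, hx, hy⟩ := hr
  obtain ⟨heq, hf, ha, hb⟩ := hs
  have hei := h.idem_of_mem e he
  have hfi := h.idem_of_mem f hf
  have hconj : (x * e * ↑x⁻¹ : R) = a * f * ↑a⁻¹ := by
    refine h.factorizable.idem_eq_of_mul_unit_eq (isIdempotentElem_conj hei x)
      (isIdempotentElem_conj hfi a) (u := x * y) (v := a * b) ?_
    simpa [mul_assoc] using heq
  have hef : e = f := by
    refine h.eq_of_conj (isIdempotentElem_conj hei x) he hf (u := x⁻¹) (v := a⁻¹) ?_ ?_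
    · simp [mul_assoc]
    · rw [hconj]; simp [mul_assoc]
  subst hef
  have hc : x⁻¹ * a ∈ commSubgroup e := by
    have h1 : (x : R) * (e * ↑x⁻¹ * a) = a * e := by
      rw [← mul_assoc, ← mul_assoc, hconj, Units.inv_mul_cancel_right]
    rw [mem_commSubgroup, Units.val_mul, mul_assoc, ← h1, Units.inv_mul_cancel_left, mul_assoc]
  have hg : x⁻¹ * a * b * y⁻¹ ∈ fixSubgroup e := by
    refine h.factorizable.mem_fixSubgroup_of_idem_mul_eq hei ?_
    rw [mul_assoc, Units.val_mul, ← mul_assoc, ← mem_commSubgroup.1 hc, Units.val_mul,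
      Units.val_mul, ← mul_assoc, Units.mul_inv_eq_iff_eq_mul, mul_assoc, mul_assoc,
      ← mul_assoc (a : R), ← heq]
    simp [mul_assoc]
  have hyb : y = b := by
    refine (eq_of_mem_minLeftReps hb hy (a := (x⁻¹ * a * b * y⁻¹)⁻¹ * (x⁻¹ * a)) ?_ ?_).symm
    · rw [h.parabolic_typeMap cs he]
      exact mul_mem (inv_mem (fixSubgroup_le_commSubgroup e hg)) hc
    · group
  subst hyb
  rw [mul_inv_cancel_right, ← h.parabolic_lowerTypeMap cs he] at hg
  refine ⟨?_, rfl, rfl⟩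
  have := eq_of_mem_minLeftReps (mem_minRightReps_iff_inv.1 ha) (mem_minRightReps_iff_inv.1 hx) hg
    (by group)
  exact (inv_injective this).symm

theorem exists_isLeftStandardForm_of_idem {E : R} (hE : IsIdempotentElem E) :
    ∃ e y, IsLeftStandardForm cs Λ E y⁻¹ e y := by
  obtain ⟨e, ⟨he, w, hw⟩, -⟩ := h.transversal E hE
  obtain ⟨c, hc, y, hy, rfl⟩ := exists_minLeftReps (cs := cs) (typeMap cs e) w
  refine ⟨e, y, ?_, he, ?_, hy⟩
  · rw [h.parabolic_typeMap cs he] at hc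
    have h1 : (↑c⁻¹ * e * ↑(c⁻¹)⁻¹ : R) = e := conj_eq_self_of_mem (inv_mem hc)
    rw [← hw] at h1 ⊢
    rw [← h1]
    simp [mul_assoc]
  · rw [mem_minRightReps_iff_inv, inv_inv]
    refine minLeftReps_anti ?_ hy
    exact fun i hi => hi.1.trans hi.2.symm

/-! ### The relation `≤⁺` -/

/-- The relation `≤⁺` in terms of given standard forms. As `x` is minimal in `x W_{λ_*(e)}`, the two
factors of the twisting element `w` act separately. -/
theorem adherencePlusLE_iff {r s : R} {x y a b : Rˣ} {e f : R}
    (hr : IsLeftStandardForm cs Λ r x e y) (hs : IsLeftStandardForm cs Λ s a f b) :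
    AdherencePlusLE cs Λ r s ↔ IdemLE e f ∧ ∃ p ∈ parabolic cs (upperTypeMap cs f),
      ∃ q ∈ parabolic cs (lowerTypeMap cs e),
        BruhatLE cs x⁻¹ (p * a⁻¹) ∧ BruhatLE cs (q * (p * b)) y := by
  have hx := mem_minRightReps_iff_inv.1 hr.2.2.1
  constructor
  · rintro ⟨x', e', y', a', f', b', hr', hs', hle, _, ⟨w₁, hw₁, w₂, hw₂, rfl⟩, h1, h2⟩
    obtain ⟨rfl, rfl, rfl⟩ := h.isLeftStandardForm_unique hr hr'
    obtain ⟨rfl, rfl, rfl⟩ := h.isLeftStandardForm_unique hs hs'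
    refine ⟨hle, w₁⁻¹, inv_mem hw₁, w₂⁻¹, inv_mem hw₂, ?_, ?_⟩
    · simpa [mul_assoc] using h1.inv.parabolic_mul hx hw₂
    · simpa [mul_assoc] using h2
  · rintro ⟨hle, p, hp, q, hq, h1, h2⟩
    refine ⟨x, e, y, a, f, b, hr, hs, hle, p⁻¹ * q⁻¹,
      Set.mul_mem_mul (inv_mem hp) (inv_mem hq), ?_, ?_⟩
    · simpa [mul_assoc] using (h1.parabolic_mul hx hq).inv
    · simpa [mul_assoc] using h2

theorem adherencePlusLE_refl (r : R) : AdherencePlusLE cs Λ r r := by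
  obtain ⟨x, e, y, hr⟩ := h.exists_isLeftStandardForm r
  refine (h.adherencePlusLE_iff hr hr).2 ⟨IdemLE.refl (h.idem_of_mem e hr.2.1), 1, one_mem _, 1,
    one_mem _, ?_, ?_⟩
  · simpa using BruhatLE.refl _
  · simpa using BruhatLE.refl _

theorem adherencePlusLE_trans {r s t : R} (hrs : AdherencePlusLE cs Λ r s)
    (hst : AdherencePlusLE cs Λ s t) : AdherencePlusLE cs Λ r t := by
  obtain ⟨x, e, y, hr⟩ := h.exists_isLeftStandardForm r
  obtain ⟨a, f, b, hs⟩ := h.exists_isLeftStandardForm s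
  obtain ⟨c, g, d, ht⟩ := h.exists_isLeftStandardForm t
  obtain ⟨hef, p₁, hp₁, q₁, hq₁, hxa, hby⟩ := (h.adherencePlusLE_iff hr hs).1 hrs
  obtain ⟨hfg, p₂, hp₂, q₂, hq₂, hac, hdb⟩ := (h.adherencePlusLE_iff hs ht).1 hst
  have hb : b ∈ minLeftReps cs (upperTypeMap cs f) :=
    minLeftReps_anti (fun i hi => hi.1) hs.2.2.2
  -- Replace `p₁` by `p'` so that both Bruhat inequalities of `s ≤⁺ t` may be multiplied.
  obtain ⟨p', hp', h1, h2⟩ := hac.exists_parabolic_mul_pair hdb hb hp₁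
  obtain ⟨q', hq', h3⟩ := h2.exists_parabolic_mul hq₁
  refine (h.adherencePlusLE_iff hr ht).2 ⟨hef.trans hfg, p' * p₂,
    mul_mem (parabolic_mono (h.upperTypeMap_mono f hs.2.1 g ht.2.1 hfg) hp') hp₂, q' * q₂,
    mul_mem hq' (parabolic_mono (lowerTypeMap_anti cs hef) hq₂), ?_, ?_⟩
  · rw [mul_assoc]
    exact hxa.trans h1
  · have hcomm : q' * q₂ * (p' * p₂ * d) = q' * (p' * (q₂ * (p₂ * d))) := by
      rw [← mul_assoc p' q₂, h.upper_mul_lower_comm hs.2.1 hp' hq₂]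
      simp only [mul_assoc]
    rw [hcomm]
    exact h3.trans hby

theorem adherencePlusLE_antisymm {r s : R} (hrs : AdherencePlusLE cs Λ r s)
    (hsr : AdherencePlusLE cs Λ s r) : r = s := by
  obtain ⟨x, e, y, hr⟩ := h.exists_isLeftStandardForm r
  obtain ⟨a, f, b, hs⟩ := h.exists_isLeftStandardForm s
  obtain ⟨hef, p₁, hp₁, q₁, hq₁, hxa, hby⟩ := (h.adherencePlusLE_iff hr hs).1 hrs
  obtain ⟨hfe, p₂, hp₂, q₂, hq₂, hax, hyb⟩ := (h.adherencePlusLE_iff hs hr).1 hsr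
  obtain rfl := hef.antisymm hfe
  have he := hr.2.1
  have hmem {p q : Rˣ} (hp : p ∈ parabolic cs (upperTypeMap cs e))
      (hq : q ∈ parabolic cs (lowerTypeMap cs e)) : q * p ∈ parabolic cs (typeMap cs e) := by
    rw [h.parabolic_typeMap cs he]
    exact mul_mem (h.parabolic_lower_le_commSubgroup he hq)
      (h.parabolic_upper_le_commSubgroup he hp)
  rw [← mul_assoc] at hby hyb
  have hb := mem_minLeftReps.1 hs.2.2.2 _ (hmem hp₁ hq₁)
  have hy := mem_minLeftReps.1 hr.2.2.2 _ (hmem hp₂ hq₂)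
  obtain rfl : y = b := (hy.trans hyb).antisymm (hb.trans hby)
  -- Both twisting elements fix `y`, hence are trivial, so that `p₁` and `p₂` lie in `W_{λ_*(e)}`.
  have h1 : p₁⁻¹ = q₁ := inv_eq_of_mul_eq_one_left (mul_eq_right.1 (hby.antisymm hb))
  have h2 : p₂⁻¹ = q₂ := inv_eq_of_mul_eq_one_left (mul_eq_right.1 (hyb.antisymm hy))
  have hxa' := hxa.parabolic_mul (mem_minRightReps_iff_inv.1 hr.2.2.1) hq₁
  have hax' := hax.parabolic_mul (mem_minRightReps_iff_inv.1 hs.2.2.1) hq₂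
  rw [← h1, inv_mul_cancel_left] at hxa'
  rw [← h2, inv_mul_cancel_left] at hax'
  rw [hr.1, hs.1, inv_injective (hxa'.antisymm hax')]

theorem one_mem_transversal : (1 : R) ∈ Λ := by
  obtain ⟨e, ⟨he, w, hw⟩, -⟩ := h.transversal 1 IsIdempotentElem.one
  simpa [← hw] using he

theorem isLeftStandardForm_unit (u : Rˣ) : IsLeftStandardForm cs Λ (u : R) u 1 1 := by
  refine ⟨by simp, h.one_mem_transversal, ?_, one_mem_minLeftReps⟩
  rw [mem_minRightReps_iff_inv, mem_minLeftReps, h.parabolic_lowerTypeMap cs h.one_mem_transversal]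
  rintro a ⟨ha, -⟩
  obtain rfl : a = 1 := by simpa using ha
  simpa using BruhatLE.refl _

theorem adherencePlusLE_unit_iff {u v : Rˣ} :
    AdherencePlusLE cs Λ (u : R) (v : R) ↔ BruhatLE cs u v := by
  rw [h.adherencePlusLE_iff (h.isLeftStandardForm_unit u) (h.isLeftStandardForm_unit v)]
  constructor
  · rintro ⟨-, p, -, q, hq, h1, h2⟩
    rw [h.parabolic_lowerTypeMap cs h.one_mem_transversal] at hq
    obtain rfl : q = 1 := by simpa using hq.1
    rw [one_mul, mul_one] at h2
    obtain rfl := h2.eq_one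
    simpa using h1.inv
  · intro huv
    exact ⟨IdemLE.refl IsIdempotentElem.one, 1, one_mem _, 1, one_mem _,
      by simpa using huv.inv, by simpa using BruhatLE.refl _⟩

theorem adherencePlusLE_idem_iff {E F : R} (hE : IsIdempotentElem E) (hF : IsIdempotentElem F) :
    AdherencePlusLE cs Λ E F ↔ IdemLE E F := by
  obtain ⟨e, y, hEy⟩ := h.exists_isLeftStandardForm_of_idem hE
  obtain ⟨f, b, hFb⟩ := h.exists_isLeftStandardForm_of_idem hF
  have he := hEy.2.1
  have hf := hFb.2.1
  rw [h.adherencePlusLE_iff hEy hFb]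
  simp only [inv_inv]
  constructor
  · rintro ⟨hef, p, hp, q, hq, h1, h2⟩
    have hy : y = q * (p * b) := by
      refine (h1.parabolic_mul (minLeftReps_anti ?_ hEy.2.2.2) hq).antisymm h2
      exact fun i hi => hi.1.trans hi.2.symm
    -- `E` and `F` are conjugate to `e` and `f` by the same element `p * b`.
    have hq' := conj_eq_self_of_mem (inv_mem (h.parabolic_lower_le_commSubgroup he hq))
    have hp' := conj_eq_self_of_mem (inv_mem (h.parabolic_upper_le_commSubgroup hf hp))
    have hE' : E = (p * b)⁻¹.1 * e * ↑((p * b)⁻¹)⁻¹ := by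
      rw [hEy.1, hy]
      nth_rw 2 [← hq']
      simp [mul_assoc]
    have hF' : F = (p * b)⁻¹.1 * f * ↑((p * b)⁻¹)⁻¹ := by
      rw [hFb.1]
      nth_rw 1 [← hp']
      simp [mul_assoc]
    rw [hE', hF']
    exact hef.conj _
  · intro hEF
    obtain ⟨w, e', he', f', hf', hef, hwE, hwF⟩ := h.conj_pair E F hE hF hEF
    have hyE : (y * E * ↑y⁻¹ : R) = e := by rw [hEy.1]; simp [mul_assoc]
    have hbF : (b * F * ↑b⁻¹ : R) = f := by rw [hFb.1]; simp [mul_assoc]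
    obtain rfl := h.eq_of_conj hE he' he hwE hyE
    obtain rfl := h.eq_of_conj hF hf' hf hwF hbF
    have hcomm {E e : R} {w y : Rˣ} (hw : (w * E * ↑w⁻¹ : R) = e) (hy : (y * E * ↑y⁻¹ : R) = e) :
        w * y⁻¹ ∈ commSubgroup e := by
      rw [mem_commSubgroup]
      nth_rw 1 [← hy]
      rw [← hw]
      simp [mul_assoc]
    obtain ⟨c₂, hc₂, c₁, hc₁, hc⟩ := h.exists_upper_mul_lower hf (hcomm hwF hbF)
    have hc₁' := parabolic_mono (lowerTypeMap_anti cs hef) hc₁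
    obtain ⟨d₂, hd₂, d₁, hd₁, hd⟩ := h.exists_upper_mul_lower he
      (mul_mem (inv_mem (h.parabolic_lower_le_commSubgroup he hc₁')) (hcomm hwE hyE))
    have hd₂' := parabolic_mono (h.upperTypeMap_mono _ he _ hf hef) hd₂
    have key : d₂⁻¹ * c₂ * b = d₁ * y := by
      rw [mul_assoc, inv_mul_eq_iff_eq_mul, ← mul_assoc, ← hd]
      rw [h.upper_mul_lower_comm hf hc₂ hc₁] at hc
      rw [← inv_mul_eq_iff_eq_mul.2 hc]
      group
    refine ⟨hef, d₂⁻¹ * c₂, mul_mem (inv_mem hd₂') hc₂, d₁⁻¹, inv_mem hd₁, ?_, ?_⟩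
    · rw [key]
      refine mem_minLeftReps.1 hEy.2.2.2 _ ?_
      rw [h.parabolic_typeMap cs he]
      exact h.parabolic_lower_le_commSubgroup he hd₁
    · rw [key, inv_mul_cancel_left]
      exact BruhatLE.refl _

end IsGenRennerCoxeterSystem

section WeakInverse

variable {R : Type*} [Monoid R]

/-! ### The inverse-monoid involution and the relation `≤⁻` -/

/-- `r'` is an inverse of `r` in the sense of inverse semigroups. -/
def IsWeakInverse (r r' : R) : Prop := r * r' * r = r ∧ r' * r * r' = r'

theorem isWeakInverse_of_idem {e : R} (he : IsIdempotentElem e) (u v : Rˣ) :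
    IsWeakInverse (u * e * v : R) (↑v⁻¹ * e * ↑u⁻¹) := by
  have key (u v : Rˣ) : (u * e * v : R) * (↑v⁻¹ * e * ↑u⁻¹) * (u * e * v) = u * e * v := by
    have : (u * e * v : R) * (↑v⁻¹ * e * ↑u⁻¹) * (u * e * v) = u * (e * e * e) * v := by
      simp [mul_assoc]
    rw [this, he.eq, he.eq]
  exact ⟨key u v, by simpa using key v⁻¹ u⁻¹⟩

namespace IsFactorizable

variable (hR : IsFactorizable R)
include hR

theorem isWeakInverse_unique {r a b : R} (ha : IsWeakInverse r a) (hb : IsWeakInverse r b) :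
    a = b := by
  have hidem {r a : R} (h : IsWeakInverse r a) :
      IsIdempotentElem (r * a) ∧ IsIdempotentElem (a * r) :=
    ⟨by rw [IsIdempotentElem, ← mul_assoc, h.1], by rw [IsIdempotentElem, ← mul_assoc, h.2]⟩
  have h1 : a = a * r * b := calc
    a = a * ((r * b * r) * a) := by rw [hb.1, ← mul_assoc, ha.2]
    _ = a * ((r * b) * (r * a)) := by simp only [mul_assoc]
    _ = a * ((r * a) * (r * b)) := by rw [hR.idem_comm _ _ (hidem hb).1 (hidem ha).1]
    _ = (a * r * a) * r * b := by simp only [mul_assoc]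
    _ = a * r * b := by rw [ha.2]
  calc
    a = a * r * b := h1
    _ = a * r * (b * r * b) := by rw [hb.2]
    _ = ((a * r) * (b * r)) * b := by simp only [mul_assoc]
    _ = ((b * r) * (a * r)) * b := by rw [hR.idem_comm _ _ (hidem ha).2 (hidem hb).2]
    _ = b * (r * a * r) * b := by simp only [mul_assoc]
    _ = b := by rw [ha.1, hb.2]

theorem exists_isWeakInverse (r : R) : ∃ r', IsWeakInverse r r' := by
  obtain ⟨e, he, u, rfl⟩ := hR.exists_idem_mul_unit r
  exact ⟨_, by simpa using isWeakInverse_of_idem he 1 u⟩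

/-- The involution of a factorizable monoid sending `u e v` to `v⁻¹ e u⁻¹`. -/
noncomputable def weakInv (r : R) : R := (hR.exists_isWeakInverse r).choose

theorem weakInv_eq_iff {r r' : R} : hR.weakInv r = r' ↔ IsWeakInverse r r' := by
  have hspec := (hR.exists_isWeakInverse r).choose_spec
  exact ⟨fun h => h ▸ hspec, hR.isWeakInverse_unique hspec⟩

theorem weakInv_weakInv (r : R) : hR.weakInv (hR.weakInv r) = r := by
  have hspec := (hR.weakInv_eq_iff (r := r)).1 rfl
  exact hR.weakInv_eq_iff.2 ⟨hspec.2, hspec.1⟩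

theorem weakInv_unit_mul_idem_mul_unit {e : R} (he : IsIdempotentElem e) (u v : Rˣ) :
    hR.weakInv (u * e * v) = ↑v⁻¹ * e * ↑u⁻¹ :=
  hR.weakInv_eq_iff.2 (isWeakInverse_of_idem he u v)

theorem weakInv_idem {e : R} (he : IsIdempotentElem e) : hR.weakInv e = e := by
  simpa using hR.weakInv_unit_mul_idem_mul_unit he 1 1

theorem weakInv_unit (u : Rˣ) : hR.weakInv (u : R) = ↑u⁻¹ := by
  simpa using hR.weakInv_unit_mul_idem_mul_unit IsIdempotentElem.one u 1

end IsFactorizable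

end WeakInverse

namespace IsGenRennerCoxeterSystem

variable {R : Type*} [Monoid R] {B : Type*} {M : CoxeterMatrix B} {cs : CoxeterSystem M Rˣ}
  {Λ : Set R} (h : IsGenRennerCoxeterSystem cs Λ)
include h

/-- The involution exchanges the two kinds of standard forms, inverting the unit factors; this
reduces `≤⁻` to `≤⁺`. -/
theorem isRightStandardForm_iff {r e : R} {x y : Rˣ} :
    IsRightStandardForm cs Λ r y e x ↔
      IsLeftStandardForm cs Λ (h.factorizable.weakInv r) x⁻¹ e y⁻¹ := by
  rw [IsRightStandardForm, IsLeftStandardForm, mem_minRightReps_iff_inv, mem_minRightReps_iff_inv,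
    inv_inv]
  constructor
  · rintro ⟨rfl, he, hx, hy⟩
    exact ⟨h.factorizable.weakInv_unit_mul_idem_mul_unit (h.idem_of_mem e he) y x, he, hx, hy⟩
  · rintro ⟨hr, he, hx, hy⟩
    refine ⟨?_, he, hx, hy⟩
    rw [← h.factorizable.weakInv_weakInv r, hr,
      h.factorizable.weakInv_unit_mul_idem_mul_unit (h.idem_of_mem e he), inv_inv, inv_inv]

theorem adherenceMinusLE_iff {r s : R} :
    AdherenceMinusLE cs Λ r s ↔
      AdherencePlusLE cs Λ (h.factorizable.weakInv r) (h.factorizable.weakInv s) := by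
  constructor
  · rintro ⟨y, e, x, b, f, a, hr, hs, hle, _, ⟨w₁, hw₁, w₂, hw₂, rfl⟩, h1, h2⟩
    refine ⟨x⁻¹, e, y⁻¹, a⁻¹, f, b⁻¹, h.isRightStandardForm_iff.1 hr,
      h.isRightStandardForm_iff.1 hs, hle, w₂⁻¹ * w₁⁻¹,
      Set.mul_mem_mul (inv_mem hw₂) (inv_mem hw₁), ?_, ?_⟩
    · simpa [mul_assoc] using h1.inv
    · simpa [mul_assoc] using h2.inv
  · rintro ⟨x, e, y, a, f, b, hr, hs, hle, _, ⟨w₁, hw₁, w₂, hw₂, rfl⟩, h1, h2⟩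
    refine ⟨y⁻¹, e, x⁻¹, b⁻¹, f, a⁻¹, h.isRightStandardForm_iff.2 (by simpa using hr),
      h.isRightStandardForm_iff.2 (by simpa using hs), hle, w₂⁻¹ * w₁⁻¹,
      Set.mul_mem_mul (inv_mem hw₂) (inv_mem hw₁), ?_, ?_⟩
    · simpa [mul_assoc] using h1.inv
    · simpa [mul_assoc] using h2.inv

theorem isPartialOrder_adherencePlusLE : IsPartialOrder R (AdherencePlusLE cs Λ) where
  refl := h.adherencePlusLE_refl
  trans _ _ _ := h.adherencePlusLE_trans
  antisymm _ _ := h.adherencePlusLE_antisymm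

theorem isPartialOrder_adherenceMinusLE : IsPartialOrder R (AdherenceMinusLE cs Λ) where
  refl _ := h.adherenceMinusLE_iff.2 (h.adherencePlusLE_refl _)
  trans _ _ _ hrs hst := h.adherenceMinusLE_iff.2
    (h.adherencePlusLE_trans (h.adherenceMinusLE_iff.1 hrs) (h.adherenceMinusLE_iff.1 hst))
  antisymm r s hrs hsr := by
    rw [← h.factorizable.weakInv_weakInv r, h.adherencePlusLE_antisymm
      (h.adherenceMinusLE_iff.1 hrs) (h.adherenceMinusLE_iff.1 hsr),
      h.factorizable.weakInv_weakInv]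

theorem adherenceMinusLE_unit_iff {u v : Rˣ} :
    AdherenceMinusLE cs Λ (u : R) (v : R) ↔ BruhatLE cs u v := by
  rw [h.adherenceMinusLE_iff, h.factorizable.weakInv_unit, h.factorizable.weakInv_unit,
    h.adherencePlusLE_unit_iff]
  exact ⟨fun huv => by simpa using huv.inv, BruhatLE.inv⟩

theorem adherenceMinusLE_idem_iff {E F : R} (hE : IsIdempotentElem E) (hF : IsIdempotentElem F) :
    AdherenceMinusLE cs Λ E F ↔ IdemLE E F := by
  rw [h.adherenceMinusLE_iff, h.factorizable.weakInv_idem hE, h.factorizable.weakInv_idem hF,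
    h.adherencePlusLE_idem_iff hE hF]

end IsGenRennerCoxeterSystem

end RennerCoxeter

theorem mainTheorem1 {R : Type*} [Monoid R] {B : Type*} {M : CoxeterMatrix B}
    (cs : CoxeterSystem M Rˣ) (Λ : Set R)
    (h : RennerCoxeter.IsGenRennerCoxeterSystem cs Λ) (ε : RennerCoxeter.AdherenceSign) :
    IsPartialOrder R (RennerCoxeter.AdherenceLE cs Λ ε) ∧
    (∀ u v : Rˣ, RennerCoxeter.AdherenceLE cs Λ ε (u : R) (v : R) ↔
      RennerCoxeter.BruhatLE cs u v) ∧
    (∀ e ∈ Λ, ∀ f ∈ Λ, RennerCoxeter.AdherenceLE cs Λ ε e f ↔ RennerCoxeter.IdemLE e f) ∧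
    (∀ e f : R, IsIdempotentElem e → IsIdempotentElem f →
      (RennerCoxeter.AdherenceLE cs Λ ε e f ↔ RennerCoxeter.IdemLE e f)) := by
  cases ε with
  | plus =>
    exact ⟨h.isPartialOrder_adherencePlusLE, fun _ _ => h.adherencePlusLE_unit_iff,
      fun e he f hf => h.adherencePlusLE_idem_iff (h.idem_of_mem e he) (h.idem_of_mem f hf),
      fun _ _ => h.adherencePlusLE_idem_iff⟩
  | minus =>
    exact ⟨h.isPartialOrder_adherenceMinusLE, fun _ _ => h.adherenceMinusLE_unit_iff,
      fun e he f hf => h.adherenceMinusLE_idem_iff (h.idem_of_mem e he) (h.idem_of_mem f hf),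
      fun _ _ => h.adherenceMinusLE_idem_iff⟩
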